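/- Let $N\ge 1$ and $0\le K<N$ be integers, and let $V:\mathbb R\to\mathbb R$ be a function for which all moments $\int |x|^k e^{-NV(x)}\,dx$, $k\ge 0$, are finite. Write $\triangle(x_1,\dots,x_n)=\prod_{i<j}(x_i-x_j)$. Consider the unitary invariant ensemble of $N\times N$ Hermitian matrices $H$ with joint eigenvalue density $$P_N(x)=Z_N^{-1}\,e^{-N\sum_{i=1}^N V(x_i)}\,\triangle(x_1,\dots,x_N)^2 ,$$ where $Z_N$ is the normalization constant, let $\langle\cdot\rangle$ denote the average with respect to $P_N(x)\,dx$, and put $Z_N(\epsilon)=\det(\epsilon-H)$. Let $\pi_k$ be the monic orthogonal polynomials for the weight $e^{-NV(x)}$ on $\mathbb R$, $\int \pi_k\pi_m e^{-NV}dx=c_kc_m\delta_{km}$ with $c_k>0$, and set $$\gamma_k=-\frac{2\pi i}{c_k^2},\qquad h_k(\epsilon)=\frac1{2\pi i}\int_{\mathbb R}\frac{e^{-NV(x)}\pi_k(x)}{x-\epsilon}\,dx\quad(\epsilon\in\mathbb C\setminus\mathbb R),$$ $$W_{III,N-K}(\epsilon,\omega)=\frac{h_{N-K}(\epsilon)h_{N-K-1}(\omega)-h_{N-K-1}(\epsilon)h_{N-K}(\omega)}{\epsilon-\omega}.$$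 Then for any pairwise distinct non-real $\epsilon_1,\dots,\epsilon_{2K}$ the function $\prod_{j=1}^{2K}Z_N(\epsilon_j)^{-1}$ is integrable with respect to $P_N(x)\,dx$ and $$\Big\langle\prod_{j=1}^{2K}\frac1{Z_N(\epsilon_j)}\Big\rangle=(-1)^K\,\frac{\gamma_{N-K-1}^{\,K}\ \prod_{l=N-K}^{N-1}\gamma_l}{(2K)!}\sum_{\pi\in S_{2K}}\frac{\det\big[W_{III,N-K}(\epsilon_{\pi(i)},\epsilon_{\pi(K+j)})\big]_{1\le i,j\le K}}{\triangle(\epsilon_{\pi(1)},\dots,\epsilon_{\pi(K)})\,\triangle(\epsilon_{\pi(K+1)},\dots,\epsilon_{\pi(2K)})}.$$ -/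

import Mathlib

open MeasureTheory Polynomial

namespace UnitaryEnsemble

/-- The weight `e^{-N V(x)}` on the real line. -/
noncomputable def weight (V : ℝ → ℝ) (N : ℕ) (x : ℝ) : ℝ :=
  Real.exp (-(N * V x))

/-- The Vandermonde determinant `△(x₁, …, xₙ) = ∏_{i < j} (xᵢ - xⱼ)`. -/
def vandermondeProd {R : Type*} [CommRing R] {n : ℕ} (x : Fin n → R) : R :=
  ∏ i, ∏ j ∈ Finset.Ioi i, (x i - x j)

/-- The unnormalized joint eigenvalue density `exp(-N ∑ᵢ V(xᵢ)) △²(x)`. -/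
noncomputable def unnormalizedDensity (V : ℝ → ℝ) (N : ℕ) (x : Fin N → ℝ) : ℝ :=
  Real.exp (-(N * ∑ i, V (x i))) * vandermondeProd x ^ 2

/-- The normalization constant `Z_N`. -/
noncomputable def partitionFunction (V : ℝ → ℝ) (N : ℕ) : ℝ :=
  ∫ x : Fin N → ℝ, unnormalizedDensity V N x

/-- The joint eigenvalue density `P_N(x) = Z_N⁻¹ exp(-N ∑ᵢ V(xᵢ)) △²(x)`. -/
noncomputable def eigenvalueDensity (V : ℝ → ℝ) (N : ℕ) (x : Fin N → ℝ) : ℝ :=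
  (partitionFunction V N)⁻¹ * unnormalizedDensity V N x

/-- The characteristic polynomial `det(ε - H)`. -/
noncomputable def charDet {N : ℕ} (ε : ℂ) (H : Matrix (Fin N) (Fin N) ℂ) : ℂ :=
  (ε • (1 : Matrix (Fin N) (Fin N) ℂ) - H).det

/-- The integrand `F(H) P_N(x)` of the ensemble average, for a function `F` of Hermitian matrices
that is invariant under unitary conjugation: `F` is evaluated at `H = diag(x₁, …, x_N)`. -/
noncomputable def averageIntegrand (V : ℝ → ℝ) (N : ℕ) (F : Matrix (Fin N) (Fin N) ℂ → ℂ)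
    (x : Fin N → ℝ) : ℂ :=
  F (Matrix.diagonal fun i => (x i : ℂ)) * (eigenvalueDensity V N x : ℂ)

/-- The ensemble average `⟨F(H)⟩_H`, the integral against `P_N(x) dx`. -/
noncomputable def average (V : ℝ → ℝ) (N : ℕ) (F : Matrix (Fin N) (Fin N) ℂ → ℂ) : ℂ :=
  ∫ x : Fin N → ℝ, averageIntegrand V N F x

/-- The bilinear form `∫ p(x) q(x) e^{-N V(x)} dx` on real polynomials. -/
noncomputable def polyInner (V : ℝ → ℝ) (N : ℕ) (p q : ℝ[X]) : ℝ :=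
  ∫ x : ℝ, p.eval x * q.eval x * weight V N x

/-- The monic orthogonal polynomials `π_k` for `e^{-N V(x)} dx`, by Gram–Schmidt applied to the
monomials. -/
noncomputable def orthoPoly (V : ℝ → ℝ) (N : ℕ) (k : ℕ) : ℝ[X] :=
  X ^ k - ∑ j : Fin k,
    C (polyInner V N (X ^ k) (orthoPoly V N j) /
      polyInner V N (orthoPoly V N j) (orthoPoly V N j)) * orthoPoly V N j
termination_by k
decreasing_by all_goals exact j.2

/-- The norms `c_k` of the monic orthogonal polynomials:
`∫ π_k(x) π_m(x) e^{-N V(x)} dx = c_k c_m δ_{km}`. -/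
noncomputable def normConst (V : ℝ → ℝ) (N : ℕ) (k : ℕ) : ℝ :=
  Real.sqrt (polyInner V N (orthoPoly V N k) (orthoPoly V N k))

/-- The constant `γ_k = -2πi / c_k²`. -/
noncomputable def gammaConst (V : ℝ → ℝ) (N : ℕ) (k : ℕ) : ℂ :=
  -(2 * (Real.pi : ℂ) * Complex.I) / (normConst V N k : ℂ) ^ 2

/-- The Cauchy transform `h_k(ε) = (2πi)⁻¹ ∫ e^{-N V(x)} π_k(x) / (x - ε) dx`. -/
noncomputable def cauchyTransform (V : ℝ → ℝ) (N : ℕ) (k : ℕ) (ε : ℂ) : ℂ :=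
  1 / (2 * (Real.pi : ℂ) * Complex.I) *
    ∫ x : ℝ, ((weight V N x * (orthoPoly V N k).eval x : ℝ) : ℂ) / ((x : ℂ) - ε)

/-- The kernel
`W_{III,n}(ε, ω) = (h_n(ε) h_{n-1}(ω) - h_{n-1}(ε) h_n(ω)) / (ε - ω)`, used for `n ≥ 1`. -/
noncomputable def kernelIII (V : ℝ → ℝ) (N : ℕ) (n : ℕ) (ε ω : ℂ) : ℂ :=
  (cauchyTransform V N n ε * cauchyTransform V N (n - 1) ω -
    cauchyTransform V N (n - 1) ε * cauchyTransform V N n ω) / (ε - ω)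

/-- The weight `e^{-N V(x)}` has finite moments of all orders. -/
def HasMoments (V : ℝ → ℝ) (N : ℕ) : Prop :=
  ∀ k : ℕ, Integrable (fun x : ℝ => x ^ k * weight V N x)

/-! Confirmation that `orthoPoly` is the system of monic orthogonal polynomials. -/

theorem orthoPoly_monic_natDegree (V : ℝ → ℝ) (N : ℕ) (k : ℕ) :
    (orthoPoly V N k).Monic ∧ (orthoPoly V N k).natDegree = k := by
  induction k using Nat.strong_induction_on with
  | _ k ih =>
    have hlt : (∑ j : Fin k,
        C (polyInner V N (X ^ k) (orthoPoly V N j) /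
          polyInner V N (orthoPoly V N j) (orthoPoly V N j)) * orthoPoly V N j).degree
        < (k : WithBot ℕ) := by
      refine (Polynomial.degree_sum_le _ _).trans_lt ?_
      refine (Finset.sup_lt_iff (WithBot.bot_lt_coe k)).2 fun j _ => ?_
      rw [← Polynomial.smul_eq_C_mul]
      refine (Polynomial.degree_smul_le _ _).trans_lt ?_
      refine Polynomial.degree_le_natDegree.trans_lt ?_
      rw [(ih j j.2).2]
      exact WithBot.coe_lt_coe.2 j.2
    have hm : (orthoPoly V N k).Monic := by
      rw [orthoPoly]
      exact Polynomial.monic_X_pow_sub hlt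
    refine ⟨hm, ?_⟩
    rw [orthoPoly]
    refine Polynomial.natDegree_eq_of_degree_eq_some ?_
    rw [Polynomial.degree_sub_eq_left_of_degree_lt] <;> simp [hlt]

theorem integrable_poly {V : ℝ → ℝ} {N : ℕ} (hV : HasMoments V N) (p : ℝ[X]) :
    Integrable (fun x : ℝ => p.eval x * weight V N x) := by
  have h : (fun x : ℝ => p.eval x * weight V N x) =
      fun x => ∑ i ∈ Finset.range (p.natDegree + 1), p.coeff i * (x ^ i * weight V N x) := by
    funext x
    rw [Polynomial.eval_eq_sum_range, Finset.sum_mul]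
    exact Finset.sum_congr rfl fun i _ => by ring
  rw [h]
  exact integrable_finsetSum _ fun i _ => (hV i).const_mul _

theorem polyInner_eq (V : ℝ → ℝ) (N : ℕ) (p q : ℝ[X]) :
    polyInner V N p q = ∫ x : ℝ, (p * q).eval x * weight V N x := by
  simp [polyInner]

theorem polyInner_comm (V : ℝ → ℝ) (N : ℕ) (p q : ℝ[X]) :
    polyInner V N p q = polyInner V N q p := by
  rw [polyInner_eq, polyInner_eq, mul_comm]

theorem polyInner_self_pos {V : ℝ → ℝ} {N : ℕ} (hV : HasMoments V N) {p : ℝ[X]} (hp : p ≠ 0) :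
    0 < polyInner V N p p := by
  have hw : ∀ x, 0 < weight V N x := fun x => Real.exp_pos _
  rw [polyInner_eq, integral_pos_iff_support_of_nonneg _ (integrable_poly hV _)]
  · have hs : (p.roots.toFinset : Set ℝ)ᶜ ⊆
        Function.support (fun x : ℝ => (p * p).eval x * weight V N x) := by
      intro x hx
      have : p.eval x ≠ 0 := by
        intro h0
        apply hx
        simp [hp, h0]
      simp [this, (hw x).ne']
    refine lt_of_lt_of_le ?_ (measure_mono hs)
    rw [measure_compl (Finset.measurableSet _) (by simp [Finset.measure_zero])]
    simp [Finset.measure_zero]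
  · intro x
    have := mul_self_nonneg (p.eval x)
    have := (hw x).le
    simp only [Pi.zero_apply, Polynomial.eval_mul]
    positivity

theorem polyInner_sub_sum {V : ℝ → ℝ} {N : ℕ} (hV : HasMoments V N) {ι : Type*} (s : Finset ι)
    (p q : ℝ[X]) (a : ι → ℝ) (f : ι → ℝ[X]) :
    polyInner V N (p - ∑ j ∈ s, C (a j) * f j) q =
      polyInner V N p q - ∑ j ∈ s, a j * polyInner V N (f j) q := by
  simp only [polyInner_eq]
  simp_rw [← integral_const_mul]
  rw [← integral_finsetSum _ fun i _ => (integrable_poly hV _).const_mul _,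
    ← integral_sub (integrable_poly hV _)
      (integrable_finsetSum _ fun i _ => (integrable_poly hV _).const_mul _)]
  congr 1
  funext x
  simp only [Polynomial.eval_mul, Polynomial.eval_sub, Polynomial.eval_finsetSum,
    Polynomial.eval_C, sub_mul, Finset.sum_mul]
  congr 1
  exact Finset.sum_congr rfl fun i _ => by ring

theorem polyInner_orthoPoly_of_lt {V : ℝ → ℝ} {N : ℕ} (hV : HasMoments V N) (k : ℕ) :
    ∀ m < k, polyInner V N (orthoPoly V N k) (orthoPoly V N m) = 0 := by
  induction k using Nat.strong_induction_on with
  | _ k ih =>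
    intro m hm
    rw [orthoPoly, polyInner_sub_sum hV, Finset.sum_eq_single (⟨m, hm⟩ : Fin k)]
    · have h := (polyInner_self_pos hV (orthoPoly_monic_natDegree V N m).1.ne_zero).ne'
      simp [h]
    · intro j _ hj
      have hjm : (j : ℕ) ≠ m := fun h => hj (Fin.ext h)
      rcases lt_or_gt_of_ne hjm with h | h
      · rw [polyInner_comm V N (orthoPoly V N j) (orthoPoly V N m), ih m hm j h, mul_zero]
      · rw [ih j j.2 m h, mul_zero]
    · simp

theorem polyInner_orthoPoly {V : ℝ → ℝ} {N : ℕ} (hV : HasMoments V N) (k m : ℕ) :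
    polyInner V N (orthoPoly V N k) (orthoPoly V N m) =
      if k = m then normConst V N k * normConst V N m else 0 := by
  split_ifs with h
  · subst h
    exact (Real.mul_self_sqrt
      (polyInner_self_pos hV (orthoPoly_monic_natDegree V N k).1.ne_zero).le).symm
  · rcases lt_or_gt_of_ne h with h | h
    · rw [polyInner_comm, polyInner_orthoPoly_of_lt hV m k h]
    · exact polyInner_orthoPoly_of_lt hV k m h

end UnitaryEnsemble

namespace UnitaryEnsemble

/-! ### Integrals of products of two determinants -/

section Andreief

variable {ι 𝕜 : Type*} [Fintype ι] [DecidableEq ι] [RCLike 𝕜]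

/-! The symmetrization is cosmetic: for every splitting of the `2K` points into halves `x`, `y`, the
summand is already the average, up to the prefactor. The sum merely adds `(2K)!` equal terms.

For one splitting, the density contains `△(t)²`, and one Vandermonde factor goes to each half. By
the mixed Cauchy–Vandermonde determinant (`det_cauchy_append_poly`), `△(x) △(t) / ∏ (t_j - x_l)` is
the determinant with rows `(t - x_k)⁻¹` and `π_0, …, π_{N-K-1}`; likewise for `y`. The integrand is
thus a product of two determinants, and Andréief's identity (`integral_det_mul_det`) turns the
integral into `N!` times a Gram determinant.

Orthogonality makes the polynomial block of the Gram matrix `diag(c_m²)`, so the determinant reduces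
to a Schur complement (`det_gram_mixedSystem`). Its entries are `∫ e^{-NV} / ((t - x)(t - y))` minus
a sum of products of Stieltjes transforms. Christoffel–Darboux for functions of the second kind
(`christoffelDarboux_stieltjes`) identifies them with `2πi γ_{N-K-1} W`. Division by `Z_N = N! ∏
c_m²` leaves the norms with `N-K ≤ l < N`, which become the product of the `γ_l`. -/

theorem det_mul_det_eq_sum (f g : ι → ℝ → 𝕜) (x : ι → ℝ) :
    (Matrix.of fun i j => f i (x j)).det * (Matrix.of fun i j => g i (x j)).det =
      ∑ σ : Equiv.Perm ι, ∑ τ : Equiv.Perm ι,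
        ((Equiv.Perm.sign σ : ℤ) : 𝕜) * ((Equiv.Perm.sign τ : ℤ) : 𝕜) *
          ∏ j, (f (σ j) (x j) * g (τ j) (x j)) := by
  simp only [Matrix.det_apply', Matrix.of_apply, Finset.sum_mul_sum]
  refine Finset.sum_congr rfl fun σ _ => Finset.sum_congr rfl fun τ _ => ?_
  rw [Finset.prod_mul_distrib]
  ring

theorem integrable_det_mul_det {f g : ι → ℝ → 𝕜}
    (h : ∀ i j, Integrable fun t => f i t * g j t) :
    Integrable fun x : ι → ℝ =>
      (Matrix.of fun i j => f i (x j)).det * (Matrix.of fun i j => g i (x j)).det := by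
  simp only [det_mul_det_eq_sum]
  refine integrable_finsetSum _ fun σ _ => integrable_finsetSum _ fun τ _ => ?_
  exact (Integrable.fintype_prod (f := fun j t => f (σ j) t * g (τ j) t)
    fun j => h (σ j) (τ j)).const_mul _

/-- The **Andréief identity**. -/
theorem integral_det_mul_det {f g : ι → ℝ → 𝕜}
    (h : ∀ i j, Integrable fun t => f i t * g j t) :
    ∫ x : ι → ℝ, (Matrix.of fun i j => f i (x j)).det * (Matrix.of fun i j => g i (x j)).det =
      (Nat.factorial (Fintype.card ι) : 𝕜) *
        (Matrix.of fun i j => ∫ t, f i t * g j t).det := by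
  have hp : ∀ σ τ : Equiv.Perm ι, Integrable fun x : ι → ℝ =>
      ((Equiv.Perm.sign σ : ℤ) : 𝕜) * ((Equiv.Perm.sign τ : ℤ) : 𝕜) *
          ∏ j, (f (σ j) (x j) * g (τ j) (x j)) := fun σ τ =>
    (Integrable.fintype_prod (f := fun j t => f (σ j) t * g (τ j) t)
      fun j => h (σ j) (τ j)).const_mul _
  simp only [det_mul_det_eq_sum]
  rw [integral_finsetSum _ fun σ _ => integrable_finsetSum _ fun τ _ => hp σ τ]
  simp_rw [integral_finsetSum _ fun τ _ => hp _ τ, integral_const_mul]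
  -- For fixed `τ`, the sum over `σ` is the determinant with columns permuted by `τ`; its sign
  -- cancels `sign τ`. All `τ` contribute equally, whence the factorial.
  rw [Finset.sum_comm]
  have hτ : ∀ τ : Equiv.Perm ι,
      ∑ σ : Equiv.Perm ι, ((Equiv.Perm.sign σ : ℤ) : 𝕜) * ((Equiv.Perm.sign τ : ℤ) : 𝕜) *
          ∫ x : ι → ℝ, ∏ j, (f (σ j) (x j) * g (τ j) (x j)) =
        (Matrix.of fun i j => ∫ t, f i t * g j t).det := by
    intro τ
    have hd := Matrix.det_permute' τ (Matrix.of fun i j => ∫ t, f i t * g j t)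
    have hs : ((Equiv.Perm.sign τ : ℤ) : 𝕜) * ((Equiv.Perm.sign τ : ℤ) : 𝕜) = 1 := by
      rw [← Int.cast_mul, ← Units.val_mul, Int.units_mul_self]
      simp
    rw [← one_mul (Matrix.det _), ← hs, mul_assoc, ← hd, Matrix.det_apply', Finset.mul_sum]
    refine Finset.sum_congr rfl fun σ _ => ?_
    rw [integral_fintype_prod_volume_eq_prod (fun j t => f (σ j) t * g (τ j) t)]
    simp only [Matrix.submatrix_apply, Matrix.of_apply, id]
    ring
  rw [Finset.sum_congr rfl fun τ _ => hτ τ, Finset.sum_const, Finset.card_univ,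
    Fintype.card_perm, nsmul_eq_mul]

end Andreief

/-! ### Mixed Cauchy–Vandermonde determinants -/

section CauchyVandermonde

theorem vandermondeProd_sq {R : Type*} [CommRing R] {n : ℕ} (x : Fin n → R) :
    vandermondeProd x ^ 2 = (Matrix.vandermonde x).det ^ 2 := by
  rw [Matrix.det_vandermonde, vandermondeProd, ← Finset.prod_pow, ← Finset.prod_pow]
  refine Finset.prod_congr rfl fun i _ => ?_
  rw [← Finset.prod_pow, ← Finset.prod_pow]
  exact Finset.prod_congr rfl fun j _ => by ring

theorem vandermondeProd_ne_zero {R : Type*} [CommRing R] [IsDomain R] {n : ℕ} {x : Fin n → R}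
    (hx : Function.Injective x) : vandermondeProd x ≠ 0 :=
  Finset.prod_ne_zero_iff.2 fun _ _ => Finset.prod_ne_zero_iff.2 fun _ hj =>
    sub_ne_zero.2 fun h => (Finset.mem_Ioi.1 hj).ne (hx h)

/-- The pairs `i < l` give `△` in the convention `x_i - x_j`, the pairs `l < i` give the opposite
convention of `Matrix.det_vandermonde`. Keeping both avoids tracking the sign `(-1)^{n(n-1)/2}`. -/
theorem prod_erase_sub {R : Type*} [CommRing R] {n : ℕ} (x : Fin n → R) :
    ∏ i, ∏ l ∈ Finset.univ.erase i, (x i - x l) =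
      vandermondeProd x * (Matrix.vandermonde x).det := by
  have h : ∀ i : Fin n, ∏ l ∈ Finset.univ.erase i, (x i - x l) =
      (∏ l ∈ Finset.Ioi i, (x i - x l)) * ∏ l ∈ Finset.Iio i, (x i - x l) := by
    intro i
    rw [← Finset.prod_union]
    · congr 1
      ext l
      simp [lt_or_lt_iff_ne, eq_comm]
    · refine Finset.disjoint_left.2 fun l h1 h2 => ?_
      simp only [Finset.mem_Ioi, Finset.mem_Iio] at h1 h2
      exact lt_asymm h1 h2
  simp_rw [h]
  rw [Finset.prod_mul_distrib, Matrix.det_vandermonde, vandermondeProd]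
  congr 1
  refine Finset.prod_comm' ?_
  simp

variable {F : Type*} [Field F]

theorem sum_coeff_mul_pow {p : F[X]} {n : ℕ} (hp : p.natDegree < n) (y : F) :
    ∑ k : Fin n, p.coeff k * y ^ (k : ℕ) = p.eval y := by
  rw [eval_eq_sum_range' hp, Fin.sum_univ_eq_sum_range fun k => p.coeff k * y ^ k]

theorem natDegree_nodal_lt {n : ℕ} (x : Fin n → F) (i : Fin n) :
    (∏ l ∈ Finset.univ.erase i, (X - C (x l))).natDegree < n := by
  rw [natDegree_prod_of_monic _ _ fun l _ => monic_X_sub_C _]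
  have := i.2
  simp
  omega

/-- The Lagrange nodal polynomials `∏_{l ≠ i} (X - xₗ)` at `n` points have coefficient determinant
`△(x)`. -/
theorem det_coeff_nodal {n : ℕ} {x : Fin n → F} (hx : Function.Injective x) :
    (Matrix.of fun i k : Fin n =>
      (∏ l ∈ Finset.univ.erase i, (X - C (x l))).coeff k).det = vandermondeProd x := by
  have hv : (Matrix.vandermonde x).det ≠ 0 := Matrix.det_vandermonde_ne_zero_iff.2 hx
  -- Multiplying by the transposed Vandermonde matrix evaluates the nodal polynomials at the points
  -- themselves, which gives a diagonal matrix.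
  refine mul_right_cancel₀ hv ?_
  rw [← prod_erase_sub, ← Matrix.det_transpose (Matrix.vandermonde x), ← Matrix.det_mul]
  rw [← Matrix.det_diagonal]
  congr 1
  ext i j
  rw [Matrix.mul_apply]
  simp only [Matrix.of_apply, Matrix.transpose_apply, Matrix.vandermonde_apply]
  rw [sum_coeff_mul_pow (natDegree_nodal_lt x i), eval_prod]
  simp only [eval_sub, eval_X, eval_C]
  by_cases hij : i = j
  · subst hij
    simp
  · rw [Matrix.diagonal_apply_ne _ hij]
    exact Finset.prod_eq_zero (Finset.mem_erase.2 ⟨Ne.symm hij, Finset.mem_univ j⟩) (sub_self _)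

/-- The Cauchy–Vandermonde determinant with denominators cleared. Its rows come from a family `P` of
monic polynomials of degrees `0, …, K+n-1` by a block-diagonal change of basis: the nodal
coefficient matrix on `1, …, X^{K-1}`, the identity on the rest. -/
theorem det_nodal_eq_mul_vandermonde {K n : ℕ} {x : Fin K → F} (hx : Function.Injective x)
    {q : Fin n → F[X]} (hq : ∀ m, (q m).Monic ∧ (q m).natDegree = m) (t : Fin (K + n) → F) :
    (Matrix.of fun i j : Fin (K + n) => Fin.append
      (fun k => ∏ l ∈ Finset.univ.erase k, (t j - x l))
      (fun m => (∏ l, (t j - x l)) * (q m).eval (t j)) i).det =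
      vandermondeProd x * (Matrix.vandermonde t).det := by
  have hX : (∏ l, (X - C (x l))).Monic := monic_prod_of_monic _ _ fun l _ => monic_X_sub_C _
  have hXd : (∏ l, (X - C (x l))).natDegree = K := by
    rw [natDegree_prod_of_monic _ _ fun l _ => monic_X_sub_C _]
    simp
  let P : Fin (K + n) → F[X] :=
    Fin.append (fun k : Fin K => X ^ (k : ℕ)) (fun m => (∏ l, (X - C (x l))) * q m)
  have hP : ∀ i, (P i).natDegree = i ∧ (P i).Monic := by
    intro i
    induction i using Fin.addCases with
    | left k => simp [P, monic_X_pow]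
    | right m =>
      simp only [P, Fin.append_right, Fin.val_natAdd]
      exact ⟨by rw [hX.natDegree_mul (hq m).1, hXd, (hq m).2], hX.mul (hq m).1⟩
  rw [Matrix.det_eval_matrixOfPolynomials_eq_det_vandermonde t P (fun i => (hP i).1)
    (fun i => (hP i).2), ← Matrix.det_transpose (Matrix.of fun i j => eval (t i) (P j)),
    ← det_coeff_nodal hx]
  set A : Matrix (Fin K) (Fin K) F := Matrix.of fun i k =>
    (∏ l ∈ Finset.univ.erase i, (X - C (x l))).coeff k with hA
  have hb : (Matrix.fromBlocks A 0 0 (1 : Matrix (Fin n) (Fin n) F)).det = A.det := by simp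
  rw [← hb, ← Matrix.det_submatrix_equiv_self finSumFinEquiv (Matrix.transpose _),
    ← Matrix.det_mul, ← Matrix.det_submatrix_equiv_self finSumFinEquiv]
  congr 1
  ext (i | m) j
  · rw [Matrix.mul_apply, Fintype.sum_sum_type]
    simp only [Matrix.submatrix_apply, Matrix.of_apply, Matrix.transpose_apply,
      finSumFinEquiv_apply_left, Fin.append_left, Matrix.fromBlocks_apply₁₁, hA,
      Matrix.fromBlocks_apply₁₂, Matrix.zero_apply, zero_mul, Finset.sum_const_zero, add_zero, P,
      eval_pow, eval_X]
    rw [sum_coeff_mul_pow (natDegree_nodal_lt x i), eval_prod]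
    simp
  · rw [Matrix.mul_apply, Fintype.sum_sum_type]
    simp [P, Matrix.one_apply, eval_prod]

/-- The mixed Cauchy–Vandermonde determinant. -/
theorem det_cauchy_append_poly {K n : ℕ} {x : Fin K → F} (hx : Function.Injective x)
    {q : Fin n → F[X]} (hq : ∀ m, (q m).Monic ∧ (q m).natDegree = m) {t : Fin (K + n) → F}
    (ht : ∀ j l, t j - x l ≠ 0) :
    (∏ j, ∏ l, (t j - x l)) * (Matrix.of fun i j : Fin (K + n) => Fin.append
      (fun k => (t j - x k)⁻¹) (fun m => (q m).eval (t j)) i).det =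
      vandermondeProd x * (Matrix.vandermonde t).det := by
  rw [← det_nodal_eq_mul_vandermonde hx hq t, ← Matrix.det_mul_row]
  congr 1
  ext i j
  simp only [Matrix.of_apply]
  induction i using Fin.addCases with
  | left k =>
    rw [Fin.append_left, Fin.append_left, ← Finset.mul_prod_erase _ _ (Finset.mem_univ k),
      mul_comm, inv_mul_cancel_left₀ (ht j k)]
  | right m => rw [Fin.append_right, Fin.append_right]

end CauchyVandermonde

/-! ### Orthogonality and the three-term recurrence -/

variable {V : ℝ → ℝ} {N : ℕ}

theorem polyInner_add_left (hV : HasMoments V N) (p q r : ℝ[X]) :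
    polyInner V N (p + q) r = polyInner V N p r + polyInner V N q r := by
  simp only [polyInner_eq]
  rw [← integral_add (integrable_poly hV _) (integrable_poly hV _)]
  congr 1
  funext x
  simp only [eval_mul, eval_add]
  ring

theorem polyInner_C_mul_left (a : ℝ) (p r : ℝ[X]) :
    polyInner V N (C a * p) r = a * polyInner V N p r := by
  simp only [polyInner_eq]
  rw [← integral_const_mul]
  congr 1
  funext x
  simp only [eval_mul, eval_C]
  ring

theorem polyInner_neg_left (p r : ℝ[X]) : polyInner V N (-p) r = -polyInner V N p r := by
  have := polyInner_C_mul_left (V := V) (N := N) (-1) p r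
  simpa using this

theorem polyInner_sub_left (hV : HasMoments V N) (p q r : ℝ[X]) :
    polyInner V N (p - q) r = polyInner V N p r - polyInner V N q r := by
  rw [sub_eq_add_neg, polyInner_add_left hV, polyInner_neg_left, sub_eq_add_neg]

theorem polyInner_X_mul (p r : ℝ[X]) : polyInner V N (X * p) r = polyInner V N p (X * r) := by
  simp only [polyInner_eq]
  congr 1
  funext x
  simp only [eval_mul, eval_X]
  ring

/-- Orthogonality to all polynomials of degree `< k` can be checked on `π₀, …, π_{k-1}`. -/
theorem polyInner_eq_zero_of_degree_lt (hV : HasMoments V N) {r : ℝ[X]} {k : ℕ}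
    (hr : ∀ j < k, polyInner V N (orthoPoly V N j) r = 0) :
    ∀ p : ℝ[X], p.degree < k → polyInner V N p r = 0 := by
  induction k with
  | zero =>
    intro p hp
    have : p = 0 := by simpa using hp
    simp [this, polyInner]
  | succ k ih =>
    intro p hp
    obtain ⟨hm, hd⟩ := orthoPoly_monic_natDegree V N k
    have hdeg : (p - C (p.coeff k) * orthoPoly V N k).degree < k := by
      rw [degree_lt_iff_coeff_zero]
      intro i hi
      rcases hi.eq_or_lt with h | hi
      · subst h
        have : (orthoPoly V N k).coeff k = 1 := by
          simpa [hd] using hm.coeff_natDegree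
        simp [this]
      · have h1 : p.coeff i = 0 := (degree_lt_iff_coeff_zero _ _).1 hp i hi
        have h2 : (orthoPoly V N k).coeff i = 0 := coeff_eq_zero_of_natDegree_lt (by rwa [hd])
        simp [h1, h2]
    have h := ih (fun j hj => hr j (hj.trans k.lt_succ_self)) _ hdeg
    rwa [polyInner_sub_left hV, polyInner_C_mul_left, hr k k.lt_succ_self, mul_zero, sub_zero]
      at h

theorem polyInner_orthoPoly_right_eq_zero (hV : HasMoments V N) {p : ℝ[X]} {k : ℕ}
    (hp : p.degree < k) : polyInner V N p (orthoPoly V N k) = 0 :=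
  polyInner_eq_zero_of_degree_lt hV
    (fun j hj => by rw [polyInner_comm, polyInner_orthoPoly_of_lt hV k j hj]) p hp

theorem eq_zero_of_forall_polyInner (hV : HasMoments V N) {p : ℝ[X]} {k : ℕ} (hp : p.degree < k)
    (h : ∀ j < k, polyInner V N (orthoPoly V N j) p = 0) : p = 0 := by
  by_contra h0
  exact (polyInner_self_pos hV h0).ne' (polyInner_eq_zero_of_degree_lt hV h p hp)

theorem degree_X_mul_orthoPoly_sub (k : ℕ) :
    (X * orthoPoly V N k - orthoPoly V N (k + 1)).degree < ((k + 1 : ℕ) : WithBot ℕ) := by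
  obtain ⟨hm, hd⟩ := orthoPoly_monic_natDegree V N k
  obtain ⟨hm', hd'⟩ := orthoPoly_monic_natDegree V N (k + 1)
  have hX : (X * orthoPoly V N k).degree = ((k + 1 : ℕ) : WithBot ℕ) := by
    rw [degree_eq_natDegree (monic_X.mul hm).ne_zero, monic_X.natDegree_mul hm, hd]
    simp [add_comm]
  have := degree_sub_lt_left (p := X * orthoPoly V N k) (q := orthoPoly V N (k + 1))
    (by rw [hX, degree_eq_natDegree hm'.ne_zero, hd']) (monic_X.mul hm).ne_zero
    (by rw [(monic_X.mul hm).leadingCoeff, hm'.leadingCoeff])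
  rwa [hX] at this

/-- The squared norm `c_k² = ∫ π_k² e^{-N V}`. -/
noncomputable def normSq (V : ℝ → ℝ) (N k : ℕ) : ℝ :=
  polyInner V N (orthoPoly V N k) (orthoPoly V N k)

theorem normSq_pos (hV : HasMoments V N) (k : ℕ) : 0 < normSq V N k :=
  polyInner_self_pos hV (orthoPoly_monic_natDegree V N k).1.ne_zero

theorem normConst_sq (hV : HasMoments V N) (k : ℕ) : normConst V N k ^ 2 = normSq V N k :=
  Real.sq_sqrt (normSq_pos hV k).le

theorem polyInner_X_mul_orthoPoly_succ (hV : HasMoments V N) (k : ℕ) :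
    polyInner V N (X * orthoPoly V N k) (orthoPoly V N (k + 1)) = normSq V N (k + 1) := by
  have h := polyInner_orthoPoly_right_eq_zero hV (degree_X_mul_orthoPoly_sub (V := V) (N := N) k)
  rw [polyInner_sub_left hV] at h
  exact sub_eq_zero.1 h

theorem polyInner_orthoPoly_ne (hV : HasMoments V N) {k m : ℕ} (h : k ≠ m) :
    polyInner V N (orthoPoly V N k) (orthoPoly V N m) = 0 := by
  rw [polyInner_orthoPoly hV, if_neg h]

theorem degree_orthoPoly (k : ℕ) : (orthoPoly V N k).degree = k := by
  rw [degree_eq_natDegree (orthoPoly_monic_natDegree V N k).1.ne_zero,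
    (orthoPoly_monic_natDegree V N k).2]

theorem orthoPoly_zero : orthoPoly V N 0 = 1 := by
  rw [orthoPoly]
  simp

theorem orthoPoly_one :
    ∃ a : ℝ, orthoPoly V N 1 = X * orthoPoly V N 0 - C a * orthoPoly V N 0 := by
  refine ⟨polyInner V N X 1 / polyInner V N 1 1, ?_⟩
  rw [orthoPoly]
  simp [orthoPoly_zero]

/-- The three-term recurrence. -/
theorem orthoPoly_add_two (hV : HasMoments V N) (k : ℕ) :
    ∃ a : ℝ, orthoPoly V N (k + 2) = X * orthoPoly V N (k + 1) - C a * orthoPoly V N (k + 1) -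
      C (normSq V N (k + 1) / normSq V N k) * orthoPoly V N k := by
  set a := polyInner V N (X * orthoPoly V N (k + 1)) (orthoPoly V N (k + 1)) / normSq V N (k + 1)
    with ha
  refine ⟨a, ?_⟩
  have hk := (normSq_pos hV k).ne'
  have hk1 := (normSq_pos hV (k + 1)).ne'
  rw [← sub_eq_zero, ← neg_eq_zero]
  refine eq_zero_of_forall_polyInner hV (k := k + 2) ?_ fun j hj => ?_
  · have e : -(orthoPoly V N (k + 2) - (X * orthoPoly V N (k + 1) - C a * orthoPoly V N (k + 1) -
        C (normSq V N (k + 1) / normSq V N k) * orthoPoly V N k)) =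
        (X * orthoPoly V N (k + 1) - orthoPoly V N (k + 2)) - C a * orthoPoly V N (k + 1) -
        C (normSq V N (k + 1) / normSq V N k) * orthoPoly V N k := by ring
    rw [e]
    have hC : ∀ (b : ℝ) (m : ℕ), m < k + 2 →
        (C b * orthoPoly V N m).degree < ((k + 2 : ℕ) : WithBot ℕ) := by
      intro b m hm
      rw [← smul_eq_C_mul]
      refine (degree_smul_le _ _).trans_lt ?_
      rw [degree_orthoPoly]
      exact_mod_cast hm
    exact (degree_sub_le _ _).trans_lt (max_lt ((degree_sub_le _ _).trans_lt
      (max_lt (degree_X_mul_orthoPoly_sub _) (hC _ _ (by omega)))) (hC _ _ (by omega)))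
  · rw [polyInner_comm, polyInner_neg_left, polyInner_sub_left hV, polyInner_sub_left hV,
      polyInner_sub_left hV, polyInner_C_mul_left, polyInner_C_mul_left,
      polyInner_orthoPoly_ne hV (by omega : k + 2 ≠ j), neg_eq_zero]
    -- For `j < k`, moving `X` onto `π_j` leaves a degree below `k + 1`; for `j = k` it produces
    -- `c_{k+1}²`, matching the last coefficient; for `j = k + 1` the choice of `a` does it.
    rcases Nat.lt_succ_iff_lt_or_eq.1 hj with hj | rfl
    · rw [polyInner_orthoPoly_ne hV (by omega : k + 1 ≠ j)]
      rcases Nat.lt_succ_iff_lt_or_eq.1 hj with hj | rfl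
      · rw [polyInner_orthoPoly_ne hV (by omega : k ≠ j), polyInner_X_mul, polyInner_comm,
          polyInner_orthoPoly_right_eq_zero hV]
        · simp
        · rw [degree_mul, degree_X, degree_orthoPoly]
          have : 1 + j < k + 1 := by omega
          exact_mod_cast this
      · rw [polyInner_X_mul, polyInner_comm, polyInner_X_mul_orthoPoly_succ hV,
          show polyInner V N (orthoPoly V N j) (orthoPoly V N j) = normSq V N j from rfl]
        field_simp
        ring
    · rw [polyInner_orthoPoly_ne hV (by omega : k ≠ k + 1), ha,
        show polyInner V N (orthoPoly V N (k + 1)) (orthoPoly V N (k + 1)) =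
          normSq V N (k + 1) from rfl]
      field_simp
      ring

/-! ### Stieltjes transforms -/

theorem ofReal_sub_ne_zero {ε : ℂ} (hε : ε.im ≠ 0) (t : ℝ) : (t : ℂ) - ε ≠ 0 := by
  intro h
  apply hε
  have := congrArg Complex.im h
  simpa using this

theorem norm_ofReal_sub_inv_le {ε : ℂ} (hε : ε.im ≠ 0) (t : ℝ) :
    ‖((t : ℂ) - ε)⁻¹‖ ≤ |ε.im|⁻¹ := by
  rw [norm_inv]
  refine inv_anti₀ (abs_pos.2 hε) ?_
  have := Complex.abs_im_le_norm ((t : ℂ) - ε)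
  simpa using this

theorem continuous_ofReal_sub_inv {ε : ℂ} (hε : ε.im ≠ 0) :
    Continuous fun t : ℝ => ((t : ℂ) - ε)⁻¹ :=
  (Complex.continuous_ofReal.sub continuous_const).inv₀ (ofReal_sub_ne_zero hε)

theorem integrable_mul_ofReal_sub_inv {ε : ℂ} (hε : ε.im ≠ 0) {f : ℝ → ℂ} (hf : Integrable f) :
    Integrable fun t : ℝ => f t * ((t : ℂ) - ε)⁻¹ :=
  hf.mul_bdd (continuous_ofReal_sub_inv hε).aestronglyMeasurable
    (Filter.Eventually.of_forall (norm_ofReal_sub_inv_le hε))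

theorem integrable_ofReal_poly (hV : HasMoments V N) (p : ℝ[X]) :
    Integrable fun t : ℝ => ((p.eval t * weight V N t : ℝ) : ℂ) :=
  (integrable_poly hV p).ofReal

/-- The Stieltjes transform `∫ p(t) e^{-N V(t)} / (t - ε) dt` of a polynomial. -/
noncomputable def stieltjes (V : ℝ → ℝ) (N : ℕ) (p : ℝ[X]) (ε : ℂ) : ℂ :=
  ∫ t : ℝ, ((p.eval t * weight V N t : ℝ) : ℂ) * ((t : ℂ) - ε)⁻¹

theorem cauchyTransform_eq (k : ℕ) (ε : ℂ) :
    cauchyTransform V N k ε =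
      (2 * (Real.pi : ℂ) * Complex.I)⁻¹ * stieltjes V N (orthoPoly V N k) ε := by
  simp only [cauchyTransform, stieltjes, one_mul, div_eq_mul_inv, mul_comm (weight V N _)]

theorem stieltjes_sub (hV : HasMoments V N) {ε : ℂ} (hε : ε.im ≠ 0) (p q : ℝ[X]) :
    stieltjes V N (p - q) ε = stieltjes V N p ε - stieltjes V N q ε := by
  simp only [stieltjes]
  rw [← integral_sub (integrable_mul_ofReal_sub_inv hε (integrable_ofReal_poly hV _))
    (integrable_mul_ofReal_sub_inv hε (integrable_ofReal_poly hV _))]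
  congr 1
  funext t
  rw [eval_sub]
  push_cast
  ring

theorem stieltjes_C_mul (a : ℝ) (p : ℝ[X]) (ε : ℂ) :
    stieltjes V N (C a * p) ε = a * stieltjes V N p ε := by
  simp only [stieltjes]
  rw [← integral_const_mul]
  congr 1
  funext t
  rw [eval_mul, eval_C]
  push_cast
  ring

/-- From `t / (t - ε) = 1 + ε / (t - ε)`. The extra constant vanishes for `p = π_k` with `k ≥ 1`, so
the transforms satisfy the recurrence of the `π_k` except at the first step. -/
theorem stieltjes_X_mul (hV : HasMoments V N) {ε : ℂ} (hε : ε.im ≠ 0) (p : ℝ[X]) :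
    stieltjes V N (X * p) ε = ε * stieltjes V N p ε + (polyInner V N p 1 : ℂ) := by
  have h1 : (polyInner V N p 1 : ℂ) = ∫ t : ℝ, ((p.eval t * weight V N t : ℝ) : ℂ) := by
    rw [polyInner_eq, mul_one]
    exact integral_ofReal.symm
  rw [h1]
  simp only [stieltjes]
  rw [← integral_const_mul, ← integral_add ((integrable_mul_ofReal_sub_inv hε
    (integrable_ofReal_poly hV _)).const_mul _) (integrable_ofReal_poly hV _)]
  congr 1
  funext t
  have := ofReal_sub_ne_zero hε t
  rw [eval_mul, eval_X]
  push_cast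
  field_simp
  ring

/-- The difference-quotient identity for `∫ e^{-N V(t)} / ((t - x) (t - y)) dt`. -/
theorem sub_mul_integral_inv_mul_inv (hV : HasMoments V N) {x y : ℂ} (hx : x.im ≠ 0)
    (hy : y.im ≠ 0) :
    (x - y) * ∫ t : ℝ, ((weight V N t : ℝ) : ℂ) * ((t : ℂ) - x)⁻¹ * ((t : ℂ) - y)⁻¹ =
      stieltjes V N (orthoPoly V N 0) x - stieltjes V N (orthoPoly V N 0) y := by
  simp only [stieltjes]
  rw [← integral_const_mul, ← integral_sub (integrable_mul_ofReal_sub_inv hx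
    (integrable_ofReal_poly hV _)) (integrable_mul_ofReal_sub_inv hy (integrable_ofReal_poly hV _))]
  congr 1
  funext t
  have := ofReal_sub_ne_zero hx t
  have := ofReal_sub_ne_zero hy t
  simp only [orthoPoly_zero, eval_one, one_mul]
  field_simp
  ring

theorem polyInner_orthoPoly_succ_one (hV : HasMoments V N) (k : ℕ) :
    polyInner V N (orthoPoly V N (k + 1)) 1 = 0 := by
  rw [← orthoPoly_zero (V := V) (N := N)]
  exact polyInner_orthoPoly_ne hV (Nat.succ_ne_zero k)

/-- The **Christoffel–Darboux formula** for the functions of the second kind. -/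
theorem christoffelDarboux_stieltjes (hV : HasMoments V N) {x y : ℂ} (hx : x.im ≠ 0)
    (hy : y.im ≠ 0) (k : ℕ) :
    (x - y) * ∑ m ∈ Finset.range (k + 1), stieltjes V N (orthoPoly V N m) x *
        stieltjes V N (orthoPoly V N m) y / (normSq V N m : ℂ) =
      (stieltjes V N (orthoPoly V N (k + 1)) x * stieltjes V N (orthoPoly V N k) y -
        stieltjes V N (orthoPoly V N k) x * stieltjes V N (orthoPoly V N (k + 1)) y) /
          (normSq V N k : ℂ) +
      (stieltjes V N (orthoPoly V N 0) x - stieltjes V N (orthoPoly V N 0) y) := by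
  have hn : ∀ m, (normSq V N m : ℂ) ≠ 0 := fun m => by exact_mod_cast (normSq_pos hV m).ne'
  induction k with
  | zero =>
    obtain ⟨a, ha⟩ := orthoPoly_one (V := V) (N := N)
    have h1 : polyInner V N (orthoPoly V N 0) 1 = normSq V N 0 := by
      rw [normSq, orthoPoly_zero]
    -- The inhomogeneous term `c_0²` here is the sole source of the boundary difference in the
    -- formula; the induction step carries it along unchanged.
    have key : ∀ {z : ℂ}, z.im ≠ 0 → stieltjes V N (orthoPoly V N 1) z =
        (z - a) * stieltjes V N (orthoPoly V N 0) z + normSq V N 0 := by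
      intro z hz
      rw [ha, stieltjes_sub hV hz, stieltjes_C_mul, stieltjes_X_mul hV hz, h1]
      ring
    have := hn 0
    rw [Finset.sum_range_one, zero_add, key hx, key hy]
    field_simp
    ring
  | succ k ih =>
    obtain ⟨a, ha⟩ := orthoPoly_add_two hV k
    have key : ∀ {z : ℂ}, z.im ≠ 0 → stieltjes V N (orthoPoly V N (k + 2)) z =
        (z - a) * stieltjes V N (orthoPoly V N (k + 1)) z -
          normSq V N (k + 1) / normSq V N k * stieltjes V N (orthoPoly V N k) z := by
      intro z hz
      rw [ha, stieltjes_sub hV hz, stieltjes_sub hV hz, stieltjes_C_mul, stieltjes_C_mul,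
        stieltjes_X_mul hV hz, polyInner_orthoPoly_succ_one hV]
      push_cast
      ring
    have := hn k
    have := hn (k + 1)
    rw [Finset.sum_range_succ, mul_add, ih, key hx, key hy]
    field_simp
    ring
-- Partition function and Gram determinant of the mixed system
theorem unnormalizedDensity_eq (V : ℝ → ℝ) (N : ℕ) (t : Fin N → ℝ) :
    unnormalizedDensity V N t = (∏ j, weight V N (t j)) * (Matrix.vandermonde t).det ^ 2 := by
  rw [unnormalizedDensity, vandermondeProd_sq]
  simp only [weight]
  rw [← Real.exp_sum, Finset.sum_neg_distrib, Finset.mul_sum]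

theorem partitionFunction_eq (hV : HasMoments V N) :
    partitionFunction V N = Nat.factorial N * ∏ m ∈ Finset.range N, normSq V N m := by
  have hint : ∀ i j : Fin N, Integrable fun t : ℝ =>
      (orthoPoly V N i).eval t * (weight V N t * (orthoPoly V N j).eval t) := by
    intro i j
    refine (integrable_poly hV (orthoPoly V N i * orthoPoly V N j)).congr
      (Filter.Eventually.of_forall fun t => ?_)
    simp only [eval_mul]
    ring
  have h := integral_det_mul_det hint
  have hG : (Matrix.of fun i j : Fin N => ∫ t : ℝ,
      (orthoPoly V N i).eval t * (weight V N t * (orthoPoly V N j).eval t)) =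
      Matrix.diagonal fun i : Fin N => normSq V N i := by
    ext i j
    have e : (∫ t : ℝ, (orthoPoly V N i).eval t * (weight V N t * (orthoPoly V N j).eval t)) =
        polyInner V N (orthoPoly V N i) (orthoPoly V N j) := by
      rw [polyInner]
      congr 1
      funext t
      ring
    rw [Matrix.of_apply, e]
    by_cases hij : i = j
    · subst hij
      rw [Matrix.diagonal_apply_eq, normSq]
    · rw [Matrix.diagonal_apply_ne _ hij,
        polyInner_orthoPoly_ne hV fun h => hij (Fin.ext h)]
  rw [hG, Matrix.det_diagonal, Fintype.card_fin, Fin.prod_univ_eq_prod_range (normSq V N)] at h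
  rw [partitionFunction]
  refine Eq.trans (congrArg _ (funext fun t => ?_)) h
  have hv := Matrix.det_eval_matrixOfPolynomials_eq_det_vandermonde t
    (fun i : Fin N => orthoPoly V N i) (fun i => (orthoPoly_monic_natDegree V N i).2)
    fun i => (orthoPoly_monic_natDegree V N i).1
  rw [← Matrix.det_transpose (Matrix.of _)] at hv
  have hw : (Matrix.of fun i j : Fin N => weight V N (t j) * (orthoPoly V N i).eval (t j)).det =
      (∏ j, weight V N (t j)) *
        (Matrix.of fun i j : Fin N => (orthoPoly V N i).eval (t j)).det :=
    Matrix.det_mul_row (fun j => weight V N (t j))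
      (Matrix.of fun i j : Fin N => (orthoPoly V N i).eval (t j))
  rw [unnormalizedDensity_eq, hw, hv]
  simp only [Matrix.transpose, Matrix.of_apply]
  ring

/-- The functions `(t - xₖ)⁻¹` for `k < K`, followed by `π₀, …, π_{n-1}`. -/
noncomputable def mixedSystem (V : ℝ → ℝ) (N : ℕ) {K : ℕ} (x : Fin K → ℂ) (n : ℕ)
    (i : Fin (K + n)) (t : ℝ) : ℂ :=
  Fin.append (fun k => ((t : ℂ) - x k)⁻¹)
    (fun m : Fin n => (((orthoPoly V N m).eval t : ℝ) : ℂ)) i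

theorem prod_mul_det_mixedSystem {K n : ℕ} {x : Fin K → ℂ} (hx : Function.Injective x)
    (him : ∀ k, (x k).im ≠ 0) (t : Fin (K + n) → ℝ) :
    (∏ j, ∏ l, ((t j : ℂ) - x l)) * (Matrix.of fun i j => mixedSystem V N x n i (t j)).det =
      vandermondeProd x * ((Matrix.vandermonde t).det : ℂ) := by
  have hq : ∀ m : Fin n, ((orthoPoly V N m).map (algebraMap ℝ ℂ)).Monic ∧
      ((orthoPoly V N m).map (algebraMap ℝ ℂ)).natDegree = m := fun m =>
    ⟨(orthoPoly_monic_natDegree V N m).1.map _, by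
      rw [natDegree_map, (orthoPoly_monic_natDegree V N m).2]⟩
  have h := det_cauchy_append_poly hx hq (t := fun j => (t j : ℂ))
    fun j l => ofReal_sub_ne_zero (him l) (t j)
  have hv : ((Matrix.vandermonde t).det : ℂ) =
      (Matrix.vandermonde fun j => (t j : ℂ)).det := by
    simp [Matrix.det_vandermonde]
  rw [hv, ← h]
  congr 2
  ext i j
  simp only [Matrix.of_apply, mixedSystem]
  congr 1
  funext m
  rw [← Complex.coe_algebraMap, eval_map_algebraMap, aeval_algebraMap_apply]
  simp

theorem integrable_mixedSystem_mul (hV : HasMoments V N) {K n : ℕ} {x y : Fin K → ℂ}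
    (hx : ∀ k, (x k).im ≠ 0) (hy : ∀ k, (y k).im ≠ 0) (i j : Fin (K + n)) :
    Integrable fun t : ℝ =>
      mixedSystem V N x n i t * ((weight V N t : ℂ) * mixedSystem V N y n j t) := by
  have hw : Integrable fun t : ℝ => (weight V N t : ℂ) := by
    simpa using integrable_ofReal_poly hV 1
  induction i using Fin.addCases with
  | left k =>
    induction j using Fin.addCases with
    | left l =>
      refine (integrable_mul_ofReal_sub_inv (hx k)
        (integrable_mul_ofReal_sub_inv (hy l) hw)).congr (Filter.Eventually.of_forall fun t => ?_)
      simp only [mixedSystem, Fin.append_left]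
      ring
    | right m =>
      refine (integrable_mul_ofReal_sub_inv (hx k) (integrable_ofReal_poly hV
        (orthoPoly V N m))).congr (Filter.Eventually.of_forall fun t => ?_)
      simp only [mixedSystem, Fin.append_left, Fin.append_right]
      push_cast
      ring
  | right m =>
    induction j using Fin.addCases with
    | left l =>
      refine (integrable_mul_ofReal_sub_inv (hy l) (integrable_ofReal_poly hV
        (orthoPoly V N m))).congr (Filter.Eventually.of_forall fun t => ?_)
      simp only [mixedSystem, Fin.append_left, Fin.append_right]
      push_cast
      ring
    | right m' =>
      refine (integrable_ofReal_poly hV (orthoPoly V N m * orthoPoly V N m')).congr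
        (Filter.Eventually.of_forall fun t => ?_)
      simp only [mixedSystem, Fin.append_right, eval_mul]
      push_cast
      ring

/-- After multiplication by `x - y`, the boundary term of Christoffel–Darboux cancels the difference
quotient. The constants agree because `2πi γ_n (2πi)⁻² = -1 / c_n²`. -/
theorem two_pi_I_mul_gammaConst_mul_kernelIII (hV : HasMoments V N) {x y : ℂ} (hx : x.im ≠ 0)
    (hy : y.im ≠ 0) (hxy : x ≠ y) (n : ℕ) :
    2 * (Real.pi : ℂ) * Complex.I * gammaConst V N n * kernelIII V N (n + 1) x y =
      (∫ t : ℝ, ((weight V N t : ℝ) : ℂ) * ((t : ℂ) - x)⁻¹ * ((t : ℂ) - y)⁻¹) -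
        ∑ m ∈ Finset.range (n + 1), stieltjes V N (orthoPoly V N m) x *
          stieltjes V N (orthoPoly V N m) y / (normSq V N m : ℂ) := by
  have hd := sub_ne_zero.2 hxy
  have h2 : 2 * (Real.pi : ℂ) * Complex.I ≠ 0 := Complex.two_pi_I_ne_zero
  have hn : (normSq V N n : ℂ) ≠ 0 := by exact_mod_cast (normSq_pos hV n).ne'
  refine mul_left_cancel₀ hd ?_
  rw [mul_sub, sub_mul_integral_inv_mul_inv hV hx hy, christoffelDarboux_stieltjes hV hx hy,
    gammaConst, ← Complex.ofReal_pow, normConst_sq hV, kernelIII, Nat.add_sub_cancel]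
  simp only [cauchyTransform_eq]
  generalize 2 * (Real.pi : ℂ) * Complex.I = c at *
  field_simp
  ring

theorem det_gram_mixedSystem (hV : HasMoments V N) {K n : ℕ} {x y : Fin K → ℂ}
    (hx : ∀ k, (x k).im ≠ 0) (hy : ∀ k, (y k).im ≠ 0) (hxy : ∀ k l, x k ≠ y l) :
    (Matrix.of fun i j => ∫ t : ℝ, mixedSystem V N x (n + 1) i t *
        ((weight V N t : ℂ) * mixedSystem V N y (n + 1) j t)).det =
      (∏ m ∈ Finset.range (n + 1), (normSq V N m : ℂ)) *
        ((2 * (Real.pi : ℂ) * Complex.I * gammaConst V N n) ^ K *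
          (Matrix.of fun k l => kernelIII V N (n + 1) (x k) (y l)).det) := by
  have hn : ∀ m, (normSq V N m : ℂ) ≠ 0 := fun m => by exact_mod_cast (normSq_pos hV m).ne'
  let d : Fin (n + 1) → ℂ := fun m => (normSq V N m : ℂ)
  have hblocks : (Matrix.of fun i j => ∫ t : ℝ, mixedSystem V N x (n + 1) i t *
        ((weight V N t : ℂ) * mixedSystem V N y (n + 1) j t)).submatrix
          finSumFinEquiv finSumFinEquiv =
      Matrix.fromBlocks
        (Matrix.of fun k l =>
          ∫ t : ℝ, ((weight V N t : ℝ) : ℂ) * ((t : ℂ) - x k)⁻¹ * ((t : ℂ) - y l)⁻¹)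
        (Matrix.of fun k (m : Fin (n + 1)) => stieltjes V N (orthoPoly V N m) (x k))
        (Matrix.of fun (m : Fin (n + 1)) l => stieltjes V N (orthoPoly V N m) (y l))
        (Matrix.diagonal d) := by
    ext (k | m) (l | m')
    · simp only [Matrix.submatrix_apply, finSumFinEquiv_apply_left, Matrix.of_apply,
        Matrix.fromBlocks_apply₁₁, mixedSystem, Fin.append_left]
      congr 1
      funext t
      ring
    · simp only [Matrix.submatrix_apply, finSumFinEquiv_apply_left, finSumFinEquiv_apply_right,
        Matrix.of_apply, Matrix.fromBlocks_apply₁₂, mixedSystem, Fin.append_left,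
        Fin.append_right, stieltjes]
      congr 1
      funext t
      push_cast
      ring
    · simp only [Matrix.submatrix_apply, finSumFinEquiv_apply_left, finSumFinEquiv_apply_right,
        Matrix.of_apply, Matrix.fromBlocks_apply₂₁, mixedSystem, Fin.append_left,
        Fin.append_right, stieltjes]
      congr 1
      funext t
      push_cast
      ring
    · have e : (∫ t : ℝ, (((orthoPoly V N m).eval t : ℝ) : ℂ) *
          ((weight V N t : ℂ) * (((orthoPoly V N m').eval t : ℝ) : ℂ))) =
          (polyInner V N (orthoPoly V N m) (orthoPoly V N m') : ℂ) := by
        have h : (fun t : ℝ => (((orthoPoly V N m).eval t : ℝ) : ℂ) *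
            ((weight V N t : ℂ) * (((orthoPoly V N m').eval t : ℝ) : ℂ))) = fun t : ℝ =>
            (((orthoPoly V N m).eval t * (orthoPoly V N m').eval t * weight V N t : ℝ) : ℂ) := by
          funext t
          push_cast
          ring
        rw [h]
        exact integral_ofReal
      simp only [Matrix.submatrix_apply, finSumFinEquiv_apply_right,
        Matrix.of_apply, Matrix.fromBlocks_apply₂₂, mixedSystem, Fin.append_right]
      rw [e]
      by_cases h : m = m'
      · subst h
        rw [Matrix.diagonal_apply_eq]
        rfl
      · rw [Matrix.diagonal_apply_ne _ h, polyInner_orthoPoly_ne hV fun h' => h (Fin.ext h'),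
          Complex.ofReal_zero]
  have hdd : Matrix.diagonal d * Matrix.diagonal (fun m => (d m)⁻¹) = 1 := by
    rw [Matrix.diagonal_mul_diagonal, ← Matrix.diagonal_one]
    congr 1
    funext m
    exact mul_inv_cancel₀ (hn m)
  -- Built from the explicit inverse, so that `⅟` in the Schur complement unfolds by `rfl`.
  let : Invertible (Matrix.diagonal d) := invertibleOfRightInverse _ _ hdd
  rw [← Matrix.det_submatrix_equiv_self finSumFinEquiv, hblocks, Matrix.det_fromBlocks₂₂,
    Matrix.det_diagonal, Fin.prod_univ_eq_prod_range fun m => (normSq V N m : ℂ),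
    show (⅟(Matrix.diagonal d)) = Matrix.diagonal (fun m => (d m)⁻¹) from rfl]
  congr 1
  have hs := Matrix.det_smul (Matrix.of fun k l => kernelIII V N (n + 1) (x k) (y l))
    (2 * (Real.pi : ℂ) * Complex.I * gammaConst V N n)
  rw [Fintype.card_fin] at hs
  rw [← hs]
  congr 1
  ext k l
  rw [Matrix.smul_apply, Matrix.of_apply, smul_eq_mul,
    two_pi_I_mul_gammaConst_mul_kernelIII hV (hx k) (hy l) (hxy k l), Matrix.sub_apply,
    Matrix.of_apply, Matrix.mul_apply, ← Fin.sum_univ_eq_sum_range fun m =>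
      stieltjes V N (orthoPoly V N m) (x k) *
          stieltjes V N (orthoPoly V N m) (y l) / (normSq V N m : ℂ)]
  congr 1
  refine Finset.sum_congr rfl fun m _ => ?_
  rw [Matrix.mul_diagonal, Matrix.of_apply, Matrix.of_apply]
  ring

/-! ### The average for one splitting of the points -/

theorem charDet_diagonal (ε : ℂ) (t : Fin N → ℝ) :
    charDet ε (Matrix.diagonal fun i => (t i : ℂ)) = ∏ i, (ε - t i) := by
  rw [charDet, ← Matrix.diagonal_one, ← Matrix.diagonal_smul, Matrix.diagonal_sub,
    Matrix.det_diagonal]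
  simp

theorem prod_charDet_mul_prod_charDet {K : ℕ} (x y : Fin K → ℂ) (t : Fin N → ℝ) :
    (∏ k, charDet (x k) (Matrix.diagonal fun i => (t i : ℂ))) *
        (∏ k, charDet (y k) (Matrix.diagonal fun i => (t i : ℂ))) =
      (∏ j, ∏ l, ((t j : ℂ) - x l)) * ∏ j, ∏ l, ((t j : ℂ) - y l) := by
  have h : ∀ z : Fin K → ℂ, (∏ k, charDet (z k) (Matrix.diagonal fun i => (t i : ℂ))) =
      ((-1) ^ N) ^ K * ∏ j, ∏ l, ((t j : ℂ) - z l) := by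
    intro z
    have h1 : ∀ k, charDet (z k) (Matrix.diagonal fun i => (t i : ℂ)) =
        (-1) ^ N * ∏ j, ((t j : ℂ) - z k) := by
      intro k
      have : (-1 : ℂ) ^ N = ∏ _j : Fin N, (-1 : ℂ) := by simp
      rw [charDet_diagonal, this, ← Finset.prod_mul_distrib]
      exact Finset.prod_congr rfl fun j _ => by ring
    rw [Finset.prod_congr rfl fun k _ => h1 k, Finset.prod_mul_distrib, Finset.prod_comm]
    simp
  -- Each of the `2K` factors `det(ε - H)` costs `(-1)^N`; their number is even.
  have hs : ((-1 : ℂ) ^ N) ^ K * ((-1) ^ N) ^ K = 1 := by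
    rw [← mul_pow, ← mul_pow]
    simp
  rw [h, h]
  linear_combination ((∏ j, ∏ l, ((t j : ℂ) - x l)) * ∏ j, ∏ l, ((t j : ℂ) - y l)) * hs

theorem averageIntegrand_eq {K n : ℕ} {x y : Fin K → ℂ}
    (hxi : Function.Injective x) (hyi : Function.Injective y)
    (hx : ∀ k, (x k).im ≠ 0) (hy : ∀ k, (y k).im ≠ 0) (t : Fin (K + n) → ℝ) :
    averageIntegrand V (K + n) (fun H => (∏ k, (charDet (x k) H)⁻¹) *
        ∏ k, (charDet (y k) H)⁻¹) t =
      ((partitionFunction V (K + n) : ℂ)⁻¹ * (vandermondeProd x * vandermondeProd y)⁻¹) *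
        ((Matrix.of fun i j => mixedSystem V (K + n) x n i (t j)).det *
          (Matrix.of fun i j => (weight V (K + n) (t j) : ℂ) *
            mixedSystem V (K + n) y n i (t j)).det) := by
  have h1 := prod_mul_det_mixedSystem (V := V) (N := K + n) hxi hx t
  have h2 := prod_mul_det_mixedSystem (V := V) (N := K + n) hyi hy t
  have hvx := vandermondeProd_ne_zero hxi
  have hvy := vandermondeProd_ne_zero hyi
  have hp : ∀ {z : Fin K → ℂ}, (∀ k, (z k).im ≠ 0) → ∏ j, ∏ l, ((t j : ℂ) - z l) ≠ 0 :=
    fun hz => Finset.prod_ne_zero_iff.2 fun j _ => Finset.prod_ne_zero_iff.2 fun l _ =>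
      ofReal_sub_ne_zero (hz l) (t j)
  have hpx := hp hx
  have hpy := hp hy
  have hrow : (Matrix.of fun i j => (weight V (K + n) (t j) : ℂ) *
      mixedSystem V (K + n) y n i (t j)).det = (∏ j, (weight V (K + n) (t j) : ℂ)) *
      (Matrix.of fun i j => mixedSystem V (K + n) y n i (t j)).det :=
    Matrix.det_mul_row _ _
  simp only [averageIntegrand]
  rw [Finset.prod_inv_distrib, Finset.prod_inv_distrib, ← mul_inv,
    prod_charDet_mul_prod_charDet, eigenvalueDensity, unnormalizedDensity_eq, hrow]
  push_cast
  generalize (Matrix.vandermonde t).det = v at *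
  generalize (∏ j, ∏ l, ((t j : ℂ) - x l)) = p at *
  generalize (∏ j, ∏ l, ((t j : ℂ) - y l)) = q at *
  rw [← eq_inv_mul_iff_mul_eq₀ hpx] at h1
  rw [← eq_inv_mul_iff_mul_eq₀ hpy] at h2
  rw [h1, h2]
  field_simp

theorem integrable_averageIntegrand_and_average_eq {K n : ℕ} (hV : HasMoments V (K + (n + 1)))
    {x y : Fin K → ℂ} (hxi : Function.Injective x) (hyi : Function.Injective y)
    (hx : ∀ k, (x k).im ≠ 0) (hy : ∀ k, (y k).im ≠ 0) (hxy : ∀ k l, x k ≠ y l) :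
    Integrable (averageIntegrand V (K + (n + 1)) fun H =>
      (∏ k, (charDet (x k) H)⁻¹) * ∏ k, (charDet (y k) H)⁻¹) ∧
    average V (K + (n + 1)) (fun H => (∏ k, (charDet (x k) H)⁻¹) * ∏ k, (charDet (y k) H)⁻¹) =
      (-1) ^ K * (gammaConst V (K + (n + 1)) n ^ K *
          ∏ l ∈ Finset.Ico (n + 1) (K + (n + 1)), gammaConst V (K + (n + 1)) l) *
        ((Matrix.of fun i j => kernelIII V (K + (n + 1)) (n + 1) (x i) (y j)).det /
          (vandermondeProd x * vandermondeProd y)) := by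
  have hint := integrable_mixedSystem_mul (n := n + 1) hV hx hy
  have hfun := funext fun t => averageIntegrand_eq (V := V) (n := n + 1) hxi hyi hx hy t
  refine ⟨?_, ?_⟩
  · rw [hfun]
    exact (integrable_det_mul_det hint).const_mul _
  · rw [average, hfun, integral_const_mul, integral_det_mul_det hint,
      det_gram_mixedSystem hV hx hy hxy, partitionFunction_eq hV, Fintype.card_fin]
    have hn : ∀ m, (normSq V (K + (n + 1)) m : ℂ) ≠ 0 := fun m => by exact_mod_cast (normSq_pos hV m).ne'
    -- The norms below `n + 1 = N - K` cancel between the Gram determinant and `Z_N`. The sign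
    -- `(-1)^K` of the formula reconciles `(2πi)^K` from the Gram determinant with `(-2πi)^K` here.
    have hγ : ∏ l ∈ Finset.Ico (n + 1) (K + (n + 1)), gammaConst V (K + (n + 1)) l =
        (-(2 * (Real.pi : ℂ) * Complex.I)) ^ K *
          (∏ l ∈ Finset.Ico (n + 1) (K + (n + 1)), (normSq V (K + (n + 1)) l : ℂ))⁻¹ := by
      have hc : ∏ _l ∈ Finset.Ico (n + 1) (K + (n + 1)), (-(2 * (Real.pi : ℂ) * Complex.I)) =
          (-(2 * (Real.pi : ℂ) * Complex.I)) ^ K := by simp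
      rw [← Finset.prod_inv_distrib, ← hc, ← Finset.prod_mul_distrib]
      refine Finset.prod_congr rfl fun l _ => ?_
      rw [gammaConst, ← Complex.ofReal_pow, normConst_sq hV, div_eq_mul_inv]
    rw [hγ, ← Finset.prod_range_mul_prod_Ico (normSq V (K + (n + 1))) (show n + 1 ≤ (K + (n + 1)) by omega)]
    have hp : ∀ s : Finset ℕ, ∏ l ∈ s, (normSq V (K + (n + 1)) l : ℂ) ≠ 0 := fun s =>
      Finset.prod_ne_zero_iff.2 fun l _ => hn l
    have h1 := hp (Finset.range (n + 1))
    have h2 := hp (Finset.Ico (n + 1) (K + (n + 1)))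
    have h3 : ((K + (n + 1)).factorial : ℂ) ≠ 0 := by exact_mod_cast Nat.factorial_ne_zero _
    have hvx := vandermondeProd_ne_zero hxi
    have hvy := vandermondeProd_ne_zero hyi
    push_cast
    rw [neg_pow (2 * (Real.pi : ℂ) * Complex.I) K, mul_pow]
    have hs : ((-1 : ℂ) ^ K) * (-1) ^ K = 1 := by
      rw [← mul_pow]
      simp
    generalize ((-1 : ℂ) ^ K) = s at *
    generalize (2 * (Real.pi : ℂ) * Complex.I) ^ K = c at *
    generalize gammaConst V (K + (n + 1)) n ^ K = g at *
    generalize (Matrix.of fun k l => kernelIII V (K + (n + 1)) (n + 1) (x k) (y l)).det = D at *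
    field_simp
    linear_combination (-(c * g * D)) * hs

end UnitaryEnsemble

/-! ### Symmetrization over all splittings -/

theorem proposition4p3 (V : ℝ → ℝ) (N K : ℕ) (hKN : K < N)
    (hV : UnitaryEnsemble.HasMoments V N)
    (ε : Fin (K + K) → ℂ) (hε : ∀ j, (ε j).im ≠ 0) (hinj : Function.Injective ε) :
    Integrable (UnitaryEnsemble.averageIntegrand V N
      fun H => ∏ j, (UnitaryEnsemble.charDet (ε j) H)⁻¹) ∧
    UnitaryEnsemble.average V N (fun H => ∏ j, (UnitaryEnsemble.charDet (ε j) H)⁻¹) =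
      (-1) ^ K *
        (UnitaryEnsemble.gammaConst V N (N - K - 1) ^ K *
          ∏ l ∈ Finset.Ico (N - K) N, UnitaryEnsemble.gammaConst V N l) /
        (Nat.factorial (2 * K) : ℂ) *
      ∑ π : Equiv.Perm (Fin (K + K)),
        (Matrix.of fun i j : Fin K => UnitaryEnsemble.kernelIII V N (N - K)
          (ε (π (Fin.castAdd K i))) (ε (π (Fin.natAdd K j)))).det /
        (UnitaryEnsemble.vandermondeProd (fun i : Fin K => ε (π (Fin.castAdd K i))) *
          UnitaryEnsemble.vandermondeProd (fun j : Fin K => ε (π (Fin.natAdd K j)))) := by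
  obtain ⟨n, rfl⟩ : ∃ n, N = K + (n + 1) := ⟨N - K - 1, by omega⟩
  have hterm := fun π : Equiv.Perm (Fin (K + K)) =>
    UnitaryEnsemble.integrable_averageIntegrand_and_average_eq hV
      (x := fun i : Fin K => ε (π (Fin.castAdd K i)))
      (y := fun j : Fin K => ε (π (Fin.natAdd K j)))
      (fun a b h => Fin.castAdd_injective K K (π.injective (hinj h)))
      (fun a b h => Fin.natAdd_injective K K (π.injective (hinj h)))
      (fun k => hε _) (fun k => hε _)
      (fun k l h => by
        have := congrArg Fin.val (π.injective (hinj h))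
        simp only [Fin.val_castAdd, Fin.val_natAdd] at this
        omega)
  -- The averaged function is symmetric in the `ε_j`, so every permutation yields the same average.
  have hF : ∀ π : Equiv.Perm (Fin (K + K)),
      (fun H : Matrix (Fin (K + (n + 1))) (Fin (K + (n + 1))) ℂ =>
        (∏ k, (UnitaryEnsemble.charDet (ε (π (Fin.castAdd K k))) H)⁻¹) *
          ∏ k, (UnitaryEnsemble.charDet (ε (π (Fin.natAdd K k))) H)⁻¹) =
      fun H => ∏ j, (UnitaryEnsemble.charDet (ε j) H)⁻¹ := by
    intro π
    funext H
    rw [← Fin.prod_univ_add (fun j => (UnitaryEnsemble.charDet (ε (π j)) H)⁻¹),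
      Equiv.prod_comp π fun j => (UnitaryEnsemble.charDet (ε j) H)⁻¹]
  simp only [hF] at hterm
  refine ⟨(hterm 1).1, ?_⟩
  have hsub : K + (n + 1) - K = n + 1 := by omega
  have h2K : 2 * K = K + K := two_mul K
  have hfac : (Nat.factorial (2 * K) : ℂ) ≠ 0 := by exact_mod_cast Nat.factorial_ne_zero _
  rw [hsub, Nat.add_sub_cancel, div_mul_eq_mul_div, eq_div_iff hfac, Finset.mul_sum,
    ← Finset.sum_congr rfl fun π _ => (hterm π).2, Finset.sum_const, Finset.card_univ,
    Fintype.card_perm, Fintype.card_fin, nsmul_eq_mul, h2K, mul_comm]
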